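/- Let $k\in\mathbb N$ and let $\mathbb S^k\subset\mathbb R^{k+1}$ be the unit sphere with its intrinsic distance $d(x,y)=\arccos(x\cdot y)$. Fix $\varepsilon\in(0,\pi/2)$ and let $\mathcal D_\varepsilon=\{x\in\mathbb S^k: d(x,\mathcal N)<\pi/2-\varepsilon\}$, where $\mathcal N=(0,\dots,0,1)$. Let $\mathcal P(\mathcal D_\varepsilon)$ be the set of Borel probability measures on $\mathcal D_\varepsilon$, and for $\mu,\nu\in\mathcal P(\mathcal D_\varepsilon)$ let $$W_1(\mu,\nu)=\inf_{\pi}\int_{\mathcal D_\varepsilon\times\mathcal D_\varepsilon} d(x,y)\,\mathrm d\pi(x,y),$$ the infimum being over all measures $\pi$ on $\mathcal D_\varepsilon\times\mathcal D_\varepsilon$ with marginals $\mu$ and $\nu$. Let $K(x,y)=g(d(x,y)^2)$ for $x,y\in\mathbb S^k$, where $g:[0,\infty)\to\mathbb R$ is differentiable with locally Lipschitz continuous derivative, and write $K_y=K(\cdot,y)$. For a curve $(\rho_t)_{t\in[0,T)}\subset\mathcal P(\mathcal D_\varepsilon)$, with $T\in(0,\infty]$, put $$v[\rho](x,t)=-\int_{\mathcal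 D_\varepsilon}\nabla_{\mathbb S^k}K_y(x)\,\mathrm d\rho_t(y),\qquad x\in\mathcal D_\varepsilon,\ t\in[0,T).$$ The curve is called a weak solution on $[0,T)$ of $\partial_t\rho-\nabla_{\mathbb S^k}\cdot(\rho\,\nabla_{\mathbb S^k}K*\rho)=0$ if there is exactly one map $\Psi:\operatorname{supp}(\rho_0)\times[0,T)\to\mathcal D_\varepsilon$ with $\frac{\mathrm d}{\mathrm dt}\Psi^t(x)=v[\rho](\Psi^t(x),t)$ and $\Psi^0(x)=x$ for all $x\in\operatorname{supp}(\rho_0)$, $t\in[0,T)$, and if $\rho_t=\Psi^t\#\rho_0$ for all $t\in[0,T)$; it is said to start from $\rho_0$. **Theorem (Mean-field limit).** Let $\rho_0\in\mathcal P(\mathcal D_\varepsilon)$ and, for every $n\in\mathbb N$, let $\rho^n_0=\sum_{i=1}^{N_n}m_i^n\,\delta_{x_i^{n,0}}$ with $N_n\geq1$, $x_i^{n,0}\in\mathcal D_\varepsilon$, $m_i^n>0$ and $\sum_{i=1}^{N_n}m_i^n=1$. Suppose that $W_1(\rho_0^n,\rho_0)\to0$ as $n\to\infty$. Let $T\in(0,\infty]$,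 let $\rho$ be a weak solution on $[0,T)$ starting from $\rho_0$ and, for every $n$, let $\rho^n$ be a weak solution on $[0,T)$ starting from $\rho^n_0$. Then every $\rho^n$ is a particle solution: there are curves $x_i^n:[0,T)\to\mathcal D_\varepsilon$, $1\le i\le N_n$, with $\rho^n_t=\sum_{i=1}^{N_n}m_i^n\,\delta_{x_i^n(t)}$, $(x_i^n)'(t)=v[\rho^n](x_i^n(t),t)$ for all $t\in[0,T)$, and $x_i^n(0)=x_i^{n,0}$. Moreover, there exists $T^*\in(0,T)$ such that $$\sup_{t\in[0,T^*)}W_1(\rho^n_t,\rho_t)\longrightarrow0\qquad\text{as }n\to\infty.$$ -/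

import Mathlib

open MeasureTheory Filter Topology
open scoped ENNReal

noncomputable section

namespace SphereAggregation

/-- The ambient Euclidean space `ℝ^{k+1}`. -/
abbrev Ambient (k : ℕ) : Type := EuclideanSpace ℝ (Fin (k + 1))

/-- The `k`-dimensional unit sphere in `ℝ^{k+1}`. -/
abbrev Sphere (k : ℕ) : Type := Metric.sphere (0 : Ambient k) 1

/-- The North pole `(0, …, 0, 1)`. -/
def northPole (k : ℕ) : Sphere k :=
  ⟨EuclideanSpace.single (Fin.last k) 1, by simp⟩

/-- The intrinsic (geodesic) distance on the unit sphere. -/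
def geoDist {k : ℕ} (x y : Sphere k) : ℝ :=
  Real.arccos (inner ℝ (x : Ambient k) (y : Ambient k))

/-- The open geodesic disk of radius `π / 2 - ε` about the North pole. -/
def cap (k : ℕ) (ε : ℝ) : Set (Sphere k) :=
  {x | geoDist x (northPole k) < Real.pi / 2 - ε}

/-- The radial retraction `z ↦ z / ‖z‖` of `ℝ^{k+1} ∖ {0}` onto the sphere
(with an irrelevant value at the origin). -/
def radialProj {k : ℕ} (z : Ambient k) : Sphere k :=
  if hz : z = 0 then northPole k
  else ⟨‖z‖⁻¹ • z, by simp [norm_smul, inv_mul_cancel₀ (norm_ne_zero_iff.mpr hz)]⟩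

/-- The Riemannian gradient on the sphere of `h`, as a vector of the ambient space: the Euclidean
gradient of the extension of `h` that is constant along rays. As the derivative of the radial
retraction at a point `x` of the sphere is the orthogonal projection onto the tangent space at `x`,
this is the tangent vector at `x` representing the differential of `h` for the induced metric. -/
def sphereGrad {k : ℕ} (h : Sphere k → ℝ) (x : Sphere k) : Ambient k :=
  gradient (fun z : Ambient k => h (radialProj z)) (x : Ambient k)

/-- Interaction potentials `K(x, y) = g(d(x, y)²)`, with `g` differentiable on `[0, ∞)` and `g'`
locally Lipschitz there. (Only the values of `g` on `[0, ∞)` play a role.) -/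
def IsAdmissiblePotential {k : ℕ} (K : Sphere k → Sphere k → ℝ) : Prop :=
  ∃ g : ℝ → ℝ, DifferentiableOn ℝ g (Set.Ici 0) ∧
    LocallyLipschitzOn (Set.Ici 0) (derivWithin g (Set.Ici 0)) ∧
    ∀ x y, K x y = g (geoDist x y ^ 2)

/-- The time interval `[0, T)`, where `T` may be `∞`. -/
def timeInterval (T : EReal) : Set ℝ := {t | 0 ≤ t ∧ (t : EReal) < T}

/-- The velocity field `v[ρ](x, t) = -(∇K * ρ_t)(x) = -∫ ∇K_y(x) dρ_t(y)`, where `K_y = K(·, y)`. -/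
def velocity {k : ℕ} {ε : ℝ} (K : Sphere k → Sphere k → ℝ)
    (ρ : ℝ → ProbabilityMeasure (cap k ε)) (x : cap k ε) (t : ℝ) : Ambient k :=
  -∫ y : cap k ε, sphereGrad (fun z => K z (y : Sphere k)) (x : Sphere k)
      ∂(ρ t : Measure (cap k ε))

/-- `c : [0, T) → cap k ε` is an integral curve of the time-dependent vector field `X`
starting from `p`. (The values of `c` outside `[0, T)` play no role; the derivative at time `0` is
one-sided.) -/
def IsIntegralCurveFrom {k : ℕ} {ε : ℝ} (X : cap k ε → ℝ → Ambient k) (T : EReal)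
    (p : cap k ε) (c : ℝ → cap k ε) : Prop :=
  c 0 = p ∧ ∀ t ∈ timeInterval T,
    HasDerivWithinAt (fun s : ℝ => ((c s : Sphere k) : Ambient k)) (X (c t) t) (timeInterval T) t

/-- `Ψ : A × [0, T) → cap k ε` is a flow map generated by `(X, A)`. (The values of `Ψ` outside
`A × [0, T)` play no role.) -/
def IsFlowMap {k : ℕ} {ε : ℝ} (X : cap k ε → ℝ → Ambient k) (A : Set (cap k ε)) (T : EReal)
    (Ψ : cap k ε → ℝ → cap k ε) : Prop :=
  ∀ x ∈ A, IsIntegralCurveFrom X T x (Ψ x)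

/-- `(ρ_t)_{t ∈ [0, T)}` is a weak solution of `∂ₜρ - ∇ ⬝ (ρ ∇K * ρ) = 0` on `[0, T)`: the velocity
field `v[ρ]` generates a unique flow map `Ψ` on `supp ρ_0 × [0, T)`, and `ρ_t` is the push-forward
of `ρ_0` under `Ψ^t`. -/
def IsWeakSolution {k : ℕ} {ε : ℝ} (K : Sphere k → Sphere k → ℝ) (T : EReal)
    (ρ : ℝ → ProbabilityMeasure (cap k ε)) : Prop :=
  ∃ Ψ : cap k ε → ℝ → cap k ε,
    IsFlowMap (velocity K ρ) (ρ 0 : Measure (cap k ε)).support T Ψ ∧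
    (∀ Φ : cap k ε → ℝ → cap k ε,
      IsFlowMap (velocity K ρ) (ρ 0 : Measure (cap k ε)).support T Φ →
      ∀ x ∈ (ρ 0 : Measure (cap k ε)).support, ∀ t ∈ timeInterval T, Φ x t = Ψ x t) ∧
    ∀ t ∈ timeInterval T,
      (ρ t : Measure (cap k ε)) = (ρ 0 : Measure (cap k ε)).map (fun x => Ψ x t)

/-- Transport plans between two measures. -/
def transportPlans {k : ℕ} {ε : ℝ} (μ ν : ProbabilityMeasure (cap k ε)) :
    Set (Measure (cap k ε × cap k ε)) :=
  {π | π.map Prod.fst = (μ : Measure (cap k ε)) ∧ π.map Prod.snd = (ν : Measure (cap k ε))}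

/-- The intrinsic `1`-Wasserstein distance. -/
def W1 {k : ℕ} {ε : ℝ} (μ ν : ProbabilityMeasure (cap k ε)) : ℝ≥0∞ :=
  ⨅ π ∈ transportPlans μ ν,
    ∫⁻ p : cap k ε × cap k ε, ENNReal.ofReal (geoDist (p.1 : Sphere k) (p.2 : Sphere k)) ∂π

/-- `m` is a collection of positive masses with total mass one. -/
def IsMassVector {N : ℕ} (m : Fin N → ℝ) : Prop := (∀ i, 0 < m i) ∧ ∑ i, m i = 1

/-- The atomic measure `∑ i, m i • δ_{x i}`. -/
def atomicMeasure {k : ℕ} {ε : ℝ} {N : ℕ} (m : Fin N → ℝ) (x : Fin N → cap k ε) :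
    Measure (cap k ε) :=
  ∑ i, ENNReal.ofReal (m i) • Measure.dirac (x i)

end SphereAggregation

end

open SphereAggregation

namespace SphereAggregation

/-! This is a Dobrushin stability estimate. Two points of the cap are at distance at most `π - 2ε`,
hence away from the cut locus, and there the gradient of the kernel is `-2 g'(θ²) (θ / sin θ) (y -
⟨x, y⟩ x)` with `θ = d(x, y)` (`sphereGrad_eq_interactionGrad`). The scalar factor is Lipschitz in
`cos θ = ⟨x, y⟩`, so the gradient is Lipschitz in both points for the chordal distance
(`exists_interactionGrad_bound`).

Given any plan between two initial measures, transport its two coordinates by the two flows. The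
result is a plan at time `t`, and the velocities along a pair of trajectories differ by at most `L`
times their distance plus `L` times the mean distance under the plan. Gronwall on a short interval
bounds the mean distance by three times its initial value (`integral_norm_sub_flow_le`). Comparing
chord and arc and taking the infimum over plans gives `W1 (ρn n t) (ρ t) ≤ C * W1 (ρ₀n n) ρ₀`,
uniformly in `t`. The particle form holds because the push-forward of a sum of atoms is a sum of
atoms, all lying in the support. -/

/-! ### Functions of the angle that are Lipschitz in its cosine -/

-- The derivative bound makes `f + C cos` and `C cos - f` both nonincreasing.
open Set Real in
theorem abs_sub_le_mul_abs_cos_sub {f f' : ℝ → ℝ} {b C : ℝ} (hb : b ≤ π)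
    (hf : ContinuousOn f (Icc 0 b)) (hf' : ∀ θ ∈ Ioo 0 b, HasDerivAt f (f' θ) θ)
    (hC : ∀ θ ∈ Ioo 0 b, |f' θ| ≤ C * sin θ) {a c : ℝ} (ha : a ∈ Icc 0 b) (hc : c ∈ Icc 0 b) :
    |f a - f c| ≤ C * |cos a - cos c| := by
  have h1 : AntitoneOn (fun θ => f θ + C * cos θ) (Icc 0 b) := by
    refine antitoneOn_of_hasDerivWithinAt_nonpos (f' := fun θ => f' θ + C * (-sin θ))
      (convex_Icc 0 b) (hf.add (by fun_prop)) ?_ ?_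
    · intro x hx
      rw [interior_Icc] at hx
      exact ((hf' x hx).add ((hasDerivAt_cos x).const_mul C)).hasDerivWithinAt
    · intro x hx
      rw [interior_Icc] at hx
      have := (abs_le.1 (hC x hx)).2
      linarith
  have h2 : AntitoneOn (fun θ => C * cos θ - f θ) (Icc 0 b) := by
    refine antitoneOn_of_hasDerivWithinAt_nonpos (f' := fun θ => C * (-sin θ) - f' θ)
      (convex_Icc 0 b) (ContinuousOn.sub (by fun_prop) hf) ?_ ?_
    · intro x hx
      rw [interior_Icc] at hx
      exact (((hasDerivAt_cos x).const_mul C).sub (hf' x hx)).hasDerivWithinAt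
    · intro x hx
      rw [interior_Icc] at hx
      have := (abs_le.1 (hC x hx)).1
      linarith
  wlog hac : a ≤ c generalizing a c
  · rw [abs_sub_comm, abs_sub_comm (cos a)]
    exact this hc ha (le_of_not_ge hac)
  have hcos : cos c ≤ cos a :=
    cos_le_cos_of_nonneg_of_le_pi ha.1 (hc.2.trans hb) hac
  rw [abs_of_nonneg (sub_nonneg.2 hcos), abs_le]
  have e1 := h1 ha hc hac
  have e2 := h2 ha hc hac
  simp only at e1 e2
  constructor <;> linarith

open Set Real in
theorem exists_pos_le_sinc {b : ℝ} (hb0 : 0 ≤ b) (hb : b < π) :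
    ∃ c > 0, ∀ θ ∈ Icc 0 b, c ≤ sinc θ := by
  obtain ⟨x, hx, hmin⟩ := isCompact_Icc.exists_isMinOn (nonempty_Icc.2 hb0)
    (continuous_sinc.continuousOn (s := Icc 0 b))
  refine ⟨sinc x, ?_, hmin⟩
  rcases hx.1.eq_or_lt with h | h
  · simp [← h]
  · rw [sinc_of_ne_zero h.ne']
    exact div_pos (sin_pos_of_pos_of_lt_pi h (hx.2.trans_lt hb)) h

open Set Real in
theorem exists_abs_sq_sub_sq_le {b : ℝ} (hb0 : 0 ≤ b) (hb : b < π) :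
    ∃ C, ∀ a ∈ Icc 0 b, ∀ c ∈ Icc 0 b, |a ^ 2 - c ^ 2| ≤ C * |cos a - cos c| := by
  obtain ⟨r, hr, hsinc⟩ := exists_pos_le_sinc hb0 hb
  refine ⟨2 / r, fun a ha c hc => abs_sub_le_mul_abs_cos_sub (f := fun θ => θ ^ 2)
    (f' := fun θ => 2 * θ) hb.le (by fun_prop) (fun θ _ => ?_) (fun θ hθ => ?_) ha hc⟩
  · simpa using hasDerivAt_pow 2 θ
  · have h := hsinc θ ⟨hθ.1.le, hθ.2.le⟩
    rw [sinc_of_ne_zero hθ.1.ne', le_div_iff₀ hθ.1] at h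
    rw [abs_of_pos (by linarith [hθ.1]), div_mul_eq_mul_div, le_div_iff₀ hr]
    linarith

open Set Real in
theorem exists_abs_inv_sinc_sub_le {b : ℝ} (hb0 : 0 ≤ b) (hb : b < π) :
    ∃ C, ∀ a ∈ Icc 0 b, ∀ c ∈ Icc 0 b,
      |(sinc a)⁻¹ - (sinc c)⁻¹| ≤ C * |cos a - cos c| := by
  obtain ⟨r, hr, hsinc⟩ := exists_pos_le_sinc hb0 hb
  refine ⟨1 / r ^ 3, fun a ha c hc => abs_sub_le_mul_abs_cos_sub (f := fun θ => (sinc θ)⁻¹)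
    (f' := fun θ => (sin θ - θ * cos θ) / sin θ ^ 2) hb.le ?_ (fun θ hθ => ?_)
    (fun θ hθ => ?_) ha hc⟩
  · exact continuous_sinc.continuousOn.inv₀ fun θ hθ => (hr.trans_le (hsinc θ hθ)).ne'
  · have hs : sin θ ≠ 0 := (sin_pos_of_pos_of_lt_pi hθ.1 (hθ.2.trans hb)).ne'
    have h : HasDerivAt (fun θ => θ / sin θ) ((1 * sin θ - θ * cos θ) / sin θ ^ 2) θ :=
      (hasDerivAt_id θ).div (hasDerivAt_sin θ) hs
    rw [one_mul] at h
    refine h.congr_of_eventuallyEq ?_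
    filter_upwards [lt_mem_nhds hθ.1] with x hx
    rw [sinc_of_ne_zero hx.ne', inv_div]
  · have h := hsinc θ ⟨hθ.1.le, hθ.2.le⟩
    have hs : 0 < sin θ := sin_pos_of_pos_of_lt_pi hθ.1 (hθ.2.trans hb)
    rw [sinc_of_ne_zero hθ.1.ne', le_div_iff₀ hθ.1] at h
    have hθ0 := hθ.1
    -- The numerator vanishes to third order at `0`, and `sin θ ≥ r θ` turns `θ³ / sin² θ` into at
    -- most `sin θ / r³`.
    have h1 : |sin θ - θ * cos θ| ≤ θ ^ 3 := by
      have e1 : sin θ ≤ θ := sin_le hθ0.le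
      have e2 := one_sub_sq_div_two_le_cos (x := θ)
      have e3 : θ - θ ^ 3 / 6 < sin θ := sin_gt_sub_cube hθ0
      have e4 := cos_le_one θ
      have e5 : θ * (1 - θ ^ 2 / 2) ≤ θ * cos θ := by gcongr
      have e6 : θ * cos θ ≤ θ * 1 := by gcongr
      have e7 : 0 < θ ^ 3 := by positivity
      rw [abs_le]
      constructor
      · linarith
      · nlinarith
    have h2 : (r * θ) ^ 3 ≤ sin θ ^ 3 := by gcongr
    rw [abs_div, abs_of_pos (pow_pos hs 2), div_le_iff₀ (pow_pos hs 2), div_mul_eq_mul_div,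
      div_mul_eq_mul_div, le_div_iff₀ (pow_pos hr 3)]
    calc _ ≤ θ ^ 3 * r ^ 3 := by gcongr
      _ ≤ _ := by linarith [mul_pow r θ 3]

/-- The scalar factor of the gradient of `g (d ^ 2)` at distance `θ`. -/
noncomputable def radialFactor (g : ℝ → ℝ) (θ : ℝ) : ℝ :=
  -2 * (derivWithin g (Set.Ici 0) (θ ^ 2) * (Real.sinc θ)⁻¹)

open Set Real in
theorem exists_radialFactor_bound {g : ℝ → ℝ}
    (hg : LocallyLipschitzOn (Ici 0) (derivWithin g (Ici 0))) {b : ℝ} (hb0 : 0 ≤ b) (hb : b < π) :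
    ∃ A, 0 ≤ A ∧ (∀ θ ∈ Icc 0 b, |radialFactor g θ| ≤ A) ∧
      ∀ a ∈ Icc 0 b, ∀ c ∈ Icc 0 b,
        |radialFactor g a - radialFactor g c| ≤ A * |cos a - cos c| := by
  obtain ⟨C₁, h₁⟩ := exists_abs_sq_sub_sq_le hb0 hb
  obtain ⟨C₂, h₂⟩ := exists_abs_inv_sinc_sub_le hb0 hb
  -- Compactness of the range of `θ²` upgrades the local Lipschitz condition to a single constant.
  obtain ⟨L, hL⟩ := (hg.mono (show Icc 0 (b ^ 2) ⊆ Ici 0 from fun _ h => h.1)).exists_lipschitzOnWith_of_compact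
    isCompact_Icc
  set P : ℝ → ℝ := fun θ => derivWithin g (Ici 0) (θ ^ 2) with hP
  have hsq : ∀ a ∈ Icc 0 b, a ^ 2 ∈ Icc 0 (b ^ 2) := fun a ha =>
    ⟨sq_nonneg a, pow_le_pow_left₀ ha.1 ha.2 2⟩
  have hPL : ∀ a ∈ Icc 0 b, ∀ c ∈ Icc 0 b, |P a - P c| ≤ L * C₁ * |cos a - cos c| := by
    intro a ha c hc
    have := hL.dist_le_mul _ (hsq a ha) _ (hsq c hc)
    rw [Real.dist_eq, Real.dist_eq] at this
    calc _ ≤ _ := this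
      _ ≤ L * (C₁ * |cos a - cos c|) := by gcongr; exact h₁ a ha c hc
      _ = _ := by ring
  -- A function Lipschitz in the cosine is bounded, because cosines differ by at most `2`.
  have bdd : ∀ (f : ℝ → ℝ) (C : ℝ),
      (∀ a ∈ Icc 0 b, ∀ c ∈ Icc 0 b, |f a - f c| ≤ C * |cos a - cos c|) →
      ∃ B, ∀ a ∈ Icc 0 b, |f a| ≤ B := by
    intro f C hf
    refine ⟨|f 0| + |C| * 2, fun a ha => ?_⟩
    have e1 := hf a ha 0 ⟨le_rfl, hb0⟩
    have e2 : |cos a - cos 0| ≤ 2 := by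
      rw [abs_le]; constructor <;> linarith [cos_le_one a, neg_one_le_cos a, cos_zero]
    have e3 : C * |cos a - cos 0| ≤ |C| * 2 := by
      calc _ ≤ |C| * |cos a - cos 0| := by gcongr; exact le_abs_self C
        _ ≤ _ := by gcongr
    have := abs_sub_abs_le_abs_sub (f a) (f 0)
    linarith
  obtain ⟨B₁, hB₁⟩ := bdd P _ hPL
  obtain ⟨B₂, hB₂⟩ := bdd (fun θ => (sinc θ)⁻¹) C₂ h₂
  have h0 : (0 : ℝ) ∈ Icc 0 b := ⟨le_rfl, hb0⟩
  have hB₁0 : 0 ≤ B₁ := (abs_nonneg _).trans (hB₁ 0 h0)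
  have hLip : ∀ a ∈ Icc 0 b, ∀ c ∈ Icc 0 b, |radialFactor g a - radialFactor g c| ≤
      2 * (B₁ * C₂ + B₂ * (L * C₁)) * |cos a - cos c| := by
    intro a ha c hc
    have e : radialFactor g a - radialFactor g c =
        -2 * (P a * ((sinc a)⁻¹ - (sinc c)⁻¹) + (sinc c)⁻¹ * (P a - P c)) := by
      simp only [radialFactor, hP]; ring
    rw [e, abs_mul]
    have e1 : |P a * ((sinc a)⁻¹ - (sinc c)⁻¹)| ≤ B₁ * (C₂ * |cos a - cos c|) := by
      rw [abs_mul]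
      exact mul_le_mul (hB₁ a ha) (h₂ a ha c hc) (abs_nonneg _) hB₁0
    have e2 : |(sinc c)⁻¹ * (P a - P c)| ≤ B₂ * (L * C₁ * |cos a - cos c|) := by
      rw [abs_mul]
      exact mul_le_mul (hB₂ c hc) (hPL a ha c hc) (abs_nonneg _)
        ((abs_nonneg _).trans (hB₂ c hc))
    have := abs_add_le (P a * ((sinc a)⁻¹ - (sinc c)⁻¹)) ((sinc c)⁻¹ * (P a - P c))
    norm_num
    linarith
  obtain ⟨B, hB⟩ := bdd _ _ hLip
  set D := 2 * (B₁ * C₂ + B₂ * (L * C₁))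
  refine ⟨max B |D|, (abs_nonneg D).trans (le_max_right _ _),
    fun θ hθ => (hB θ hθ).trans (le_max_left _ _), fun a ha c hc => (hLip a ha c hc).trans ?_⟩
  gcongr
  exact (le_abs_self D).trans (le_max_right _ _)

-- `arccos` has a vertical tangent at `1`, but its square has derivative tending to `-2` there. A
-- derivative from the left suffices, as inner products of unit vectors never exceed `1`.
open Set Real in
theorem hasDerivWithinAt_arccos_sq {s : ℝ} (hs : -1 < s) (hs1 : s ≤ 1) :
    HasDerivWithinAt (fun s => arccos s ^ 2) (-2 * (sinc (arccos s))⁻¹) (Iic 1) s := by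
  have key : ∀ s, -1 < s → s < 1 →
      HasDerivAt (fun s => arccos s ^ 2) (-2 * (sinc (arccos s))⁻¹) s := by
    intro s h1 h2
    have h := (hasDerivAt_arccos h1.ne' h2.ne).pow 2
    refine h.congr_deriv ?_
    rw [sinc_of_ne_zero (arccos_pos.2 h2).ne', sin_arccos]
    simp
    ring
  rcases hs1.eq_or_lt with rfl | h
  · refine hasDerivWithinAt_Iic_of_tendsto_deriv (s := Ioo (-1) 1)
      (fun x hx => (key x hx.1 hx.2).differentiableAt.differentiableWithinAt)
      (continuous_arccos.pow 2).continuousWithinAt (Ioo_mem_nhdsLT (by norm_num)) ?_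
    have hc : ContinuousAt (fun s => -2 * (sinc (arccos s))⁻¹) 1 := by
      refine ContinuousAt.mul continuousAt_const
        ((continuous_sinc.comp continuous_arccos).continuousAt.inv₀ (by simp))
    refine (hc.tendsto.mono_left nhdsWithin_le_nhds).congr' ?_
    filter_upwards [Ioo_mem_nhdsLT (show (-1 : ℝ) < 1 by norm_num)] with x hx
    exact (key x hx.1 hx.2).deriv.symm
  · exact (key s hs h).hasDerivWithinAt

/-! ### Geodesic and chordal distance -/

variable {k : ℕ} {ε : ℝ}

theorem norm_sphere (x : Sphere k) : ‖(x : Ambient k)‖ = 1 := by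
  simp

theorem geoDist_eq_angle (x y : Sphere k) :
    geoDist x y = InnerProductGeometry.angle (x : Ambient k) (y : Ambient k) := by
  simp [geoDist, InnerProductGeometry.angle]

theorem cos_geoDist (x y : Sphere k) :
    Real.cos (geoDist x y) = inner ℝ (x : Ambient k) (y : Ambient k) := by
  rw [geoDist_eq_angle, InnerProductGeometry.cos_angle]
  simp

theorem geoDist_nonneg (x y : Sphere k) : 0 ≤ geoDist x y := Real.arccos_nonneg _

theorem geoDist_le_of_mem_cap {x y : Sphere k} (hx : x ∈ cap k ε) (hy : y ∈ cap k ε) :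
    geoDist x y ≤ Real.pi - 2 * ε := by
  have h := InnerProductGeometry.angle_le_angle_add_angle (x : Ambient k) (northPole k) y
  rw [← geoDist_eq_angle, ← geoDist_eq_angle, InnerProductGeometry.angle_comm,
    ← geoDist_eq_angle] at h
  have hx' : geoDist x (northPole k) < Real.pi / 2 - ε := hx
  have hy' : geoDist y (northPole k) < Real.pi / 2 - ε := hy
  linarith

theorem norm_sub_sq_sphere (x y : Sphere k) :
    ‖(x : Ambient k) - y‖ ^ 2 = 2 * (1 - Real.cos (geoDist x y)) := by
  rw [norm_sub_sq_real, norm_sphere, norm_sphere, cos_geoDist]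
  ring

theorem norm_sub_le_geoDist (x y : Sphere k) : ‖(x : Ambient k) - y‖ ≤ geoDist x y := by
  refine le_of_sq_le_sq ?_ (geoDist_nonneg x y)
  rw [norm_sub_sq_sphere]
  linarith [Real.one_sub_sq_div_two_le_cos (x := geoDist x y)]

/-- Follows from `cos θ ≤ 1 - 2 θ² / π²` on `[0, π]`. -/
theorem geoDist_le_norm_sub (x y : Sphere k) :
    geoDist x y ≤ Real.pi / 2 * ‖(x : Ambient k) - y‖ := by
  have hpi := Real.pi_pos
  refine le_of_sq_le_sq ?_ (by positivity)
  rw [mul_pow, norm_sub_sq_sphere]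
  have h := Real.cos_le_one_sub_mul_cos_sq (x := geoDist x y)
    (by rw [abs_of_nonneg (geoDist_nonneg x y)]; exact Real.arccos_le_pi _)
  have h2 : Real.pi ^ 2 / 2 * (2 / Real.pi ^ 2 * geoDist x y ^ 2) = geoDist x y ^ 2 := by
    field_simp
  have : Real.pi ^ 2 / 2 * (2 / Real.pi ^ 2 * geoDist x y ^ 2) ≤
      Real.pi ^ 2 / 2 * (1 - Real.cos (geoDist x y)) := by
    gcongr; linarith
  linarith

theorem continuous_geoDist :
    Continuous fun p : cap k ε × cap k ε => geoDist (p.1 : Sphere k) p.2 := by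
  unfold geoDist
  exact Real.continuous_arccos.comp (by fun_prop)

/-! ### The gradient of the kernel and its Lipschitz bound -/

/-- Closed form of the gradient of `z ↦ g (d(z, y) ^ 2)` at `x`. -/
noncomputable def interactionGrad (g : ℝ → ℝ) (x y : Sphere k) : Ambient k :=
  radialFactor g (geoDist x y) •
    ((y : Ambient k) - (inner ℝ (x : Ambient k) (y : Ambient k) : ℝ) • (x : Ambient k))

theorem coe_radialProj {z : Ambient k} (hz : z ≠ 0) :
    (radialProj z : Ambient k) = ‖z‖⁻¹ • z := by
  simp [radialProj, hz]

theorem radialProj_coe (x : Sphere k) : radialProj (x : Ambient k) = x := by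
  have hx : (x : Ambient k) ≠ 0 := norm_ne_zero_iff.1 (by simp)
  ext1
  rw [coe_radialProj hx, norm_sphere, inv_one, one_smul]

theorem hasFDerivAt_inner_radialProj (x y : Sphere k) :
    HasFDerivAt (fun z : Ambient k => (inner ℝ (radialProj z : Ambient k) (y : Ambient k) : ℝ))
      (innerSL ℝ ((y : Ambient k) -
        (inner ℝ (x : Ambient k) (y : Ambient k) : ℝ) • (x : Ambient k))) (x : Ambient k) := by
  have hx : (x : Ambient k) ≠ 0 := norm_ne_zero_iff.1 (by simp)
  have h1 : HasFDerivAt (fun z : Ambient k => ‖z‖ ^ 2) (2 • innerSL ℝ (x : Ambient k))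
      (x : Ambient k) := (hasStrictFDerivAt_norm_sq _).hasFDerivAt
  -- The extension is `‖z‖⁻¹ ⟨z, y⟩` near `x`; the norm is differentiated as `√(‖z‖²)`.
  have h2 := (Real.hasDerivAt_sqrt (x := ‖(x : Ambient k)‖ ^ 2) (by simp)).comp_hasFDerivAt
    (f := fun z : Ambient k => ‖z‖ ^ 2) (x : Ambient k) h1
  have h3 := (hasDerivAt_inv (x := √(‖(x : Ambient k)‖ ^ 2)) (by simp)).comp_hasFDerivAt
    (x : Ambient k) h2
  have h4 := h3.mul (innerSL ℝ (y : Ambient k)).hasFDerivAt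
  refine (h4.congr_of_eventuallyEq ?_).congr_fderiv ?_
  · filter_upwards [isOpen_ne.mem_nhds hx] with z hz
    simp [coe_radialProj hz, inner_smul_left, real_inner_comm]
  · ext v
    simp [real_inner_comm]
    ring

/-- Chain rule through `z ↦ ⟨z / ‖z‖, y⟩`, then `arccos²`, then `g`. The last two have only
one-sided derivatives at `1` and `0`, enough because the inner maps stay in `(-∞, 1]` and `[0, ∞)`.
The case `x = y` is thereby included. -/
theorem sphereGrad_eq_interactionGrad {K : Sphere k → Sphere k → ℝ} {g : ℝ → ℝ}
    (hg : DifferentiableOn ℝ g (Set.Ici 0)) (hK : ∀ x y, K x y = g (geoDist x y ^ 2))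
    {x y : Sphere k} (hxy : geoDist x y < Real.pi) :
    sphereGrad (fun z => K z y) x = interactionGrad g x y := by
  have hs : -1 < (inner ℝ (x : Ambient k) (y : Ambient k) : ℝ) := by
    rw [← cos_geoDist, ← Real.cos_pi]
    exact Real.cos_lt_cos_of_nonneg_of_le_pi (geoDist_nonneg x y) le_rfl hxy
  have hle : ∀ z : Sphere k, (inner ℝ (z : Ambient k) (y : Ambient k) : ℝ) ≤ 1 := fun z => by
    rw [← cos_geoDist]; exact Real.cos_le_one _
  have h1 := (hasDerivWithinAt_arccos_sq hs (hle x)).comp_hasFDerivAt_of_eq (x : Ambient k)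
    (hasFDerivAt_inner_radialProj x y) (Eventually.of_forall fun z => hle _)
    (by rw [radialProj_coe])
  have h2 := (hg (geoDist x y ^ 2) (Set.mem_Ici.2 (sq_nonneg _))).hasDerivWithinAt.comp_hasFDerivAt_of_eq
    (x : Ambient k) h1
    (Eventually.of_forall fun z => sq_nonneg (Real.arccos _))
    (by simp [radialProj_coe, geoDist])
  have h3 : HasGradientAt (fun z : Ambient k => K (radialProj z) y) (interactionGrad g x y)
      (x : Ambient k) := by
    rw [hasGradientAt_iff_hasFDerivAt]
    refine (h2.congr_of_eventuallyEq (Eventually.of_forall fun z => ?_)).congr_fderiv ?_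
    · simp [hK, geoDist]
    · ext v
      simp only [interactionGrad, radialFactor, InnerProductSpace.toDual_apply_apply,
        real_inner_smul_left, _root_.smul_apply, innerSL_apply_apply, smul_eq_mul,
        geoDist]
      ring
  exact h3.gradient

theorem exists_interactionGrad_bound {g : ℝ → ℝ}
    (hg : LocallyLipschitzOn (Set.Ici 0) (derivWithin g (Set.Ici 0)))
    (hε : ε ∈ Set.Ioo 0 (Real.pi / 2)) :
    ∃ L : ℝ, 0 < L ∧ ∀ x ∈ cap k ε, ∀ y ∈ cap k ε, ∀ x' ∈ cap k ε, ∀ y' ∈ cap k ε,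
      ‖interactionGrad g x y - interactionGrad g x' y'‖ ≤
        L * (‖(x : Ambient k) - x'‖ + ‖(y : Ambient k) - y'‖) := by
  obtain ⟨A, hA0, hA, hLip⟩ := exists_radialFactor_bound hg (b := Real.pi - 2 * ε)
    (by linarith [hε.2]) (by linarith [hε.1])
  -- The estimate below yields `4 * A`; the excess makes the constant positive even if `A = 0`.
  refine ⟨5 * A + 1, by linarith, fun x hx y hy x' hx' y' hy' => ?_⟩
  have hm : geoDist x y ∈ Set.Icc 0 (Real.pi - 2 * ε) :=
    ⟨geoDist_nonneg x y, geoDist_le_of_mem_cap hx hy⟩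
  have hm' : geoDist x' y' ∈ Set.Icc 0 (Real.pi - 2 * ε) :=
    ⟨geoDist_nonneg x' y', geoDist_le_of_mem_cap hx' hy'⟩
  have e1 := hA _ hm'
  have e2 := hLip _ hm _ hm'
  rw [cos_geoDist, cos_geoDist] at e2
  set a := radialFactor g (geoDist x y)
  set a' := radialFactor g (geoDist x' y')
  set s : ℝ := inner ℝ (x : Ambient k) (y : Ambient k) with hs
  set s' : ℝ := inner ℝ (x' : Ambient k) (y' : Ambient k) with hs'
  set D := ‖(x : Ambient k) - x'‖ + ‖(y : Ambient k) - y'‖ with hD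
  have hss : |s - s'| ≤ D := by
    have : s - s' = inner ℝ ((x : Ambient k) - x') (y : Ambient k) +
        inner ℝ (x' : Ambient k) ((y : Ambient k) - y') := by
      simp [hs, hs', inner_sub_left, inner_sub_right]
    rw [this]
    refine (abs_add_le _ _).trans (add_le_add ?_ ?_)
    · simpa using abs_real_inner_le_norm ((x : Ambient k) - x') (y : Ambient k)
    · simpa using abs_real_inner_le_norm (x' : Ambient k) ((y : Ambient k) - y')
  have hsle : |s| ≤ 1 := by rw [hs, ← cos_geoDist]; exact Real.abs_cos_le_one _
  have hu : ‖(y : Ambient k) - s • (x : Ambient k)‖ ≤ 2 := by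
    refine (norm_sub_le _ _).trans ?_
    rw [norm_smul, norm_sphere, norm_sphere, Real.norm_eq_abs]
    linarith
  have huu : ‖((y : Ambient k) - s • (x : Ambient k)) - (y' - s' • (x' : Ambient k))‖ ≤ 2 * D := by
    have : ((y : Ambient k) - s • (x : Ambient k)) - (y' - s' • (x' : Ambient k)) =
        (y - y') - (s • ((x : Ambient k) - x') + (s - s') • (x' : Ambient k)) := by
      module
    rw [this]
    have n1 := norm_sub_le ((y : Ambient k) - y')
      (s • ((x : Ambient k) - x') + (s - s') • (x' : Ambient k))
    have n2 := norm_add_le (s • ((x : Ambient k) - x')) ((s - s') • (x' : Ambient k))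
    rw [norm_smul, norm_smul, norm_sphere, Real.norm_eq_abs, Real.norm_eq_abs, mul_one] at n2
    have n3 : |s| * ‖(x : Ambient k) - x'‖ ≤ 1 * ‖(x : Ambient k) - x'‖ := by gcongr
    linarith
  have hsplit : interactionGrad g x y - interactionGrad g x' y' =
      (a - a') • ((y : Ambient k) - s • (x : Ambient k)) +
      a' • (((y : Ambient k) - s • (x : Ambient k)) - (y' - s' • (x' : Ambient k))) := by
    simp only [interactionGrad, a, a', s, s']
    module
  have hD0 : 0 ≤ D := by positivity
  calc _ ≤ |a - a'| * ‖(y : Ambient k) - s • (x : Ambient k)‖ +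
        |a'| * ‖((y : Ambient k) - s • (x : Ambient k)) - (y' - s' • (x' : Ambient k))‖ := by
        rw [hsplit]
        refine (norm_add_le _ _).trans ?_
        rw [norm_smul, norm_smul, Real.norm_eq_abs, Real.norm_eq_abs]
    _ ≤ (A * D) * 2 + A * (2 * D) := by
        gcongr
        exact e2.trans (by gcongr)
    _ ≤ (5 * A + 1) * D := by nlinarith [mul_nonneg hA0 hD0]

/-! ### Stability of the velocity field -/

/-- `L` is a Lipschitz constant for the gradient of the kernel `g (d ^ 2)` on the cap. -/
def IsGradLipschitz (k : ℕ) (ε : ℝ) (g : ℝ → ℝ) (L : ℝ) : Prop :=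
  ∀ x y x' y' : cap k ε,
    ‖interactionGrad g (x : Sphere k) y - interactionGrad g (x' : Sphere k) y'‖ ≤
      L * (‖((x : Sphere k) : Ambient k) - (x' : Sphere k)‖ +
        ‖((y : Sphere k) : Ambient k) - (y' : Sphere k)‖)

theorem norm_sub_le_two (x y : Sphere k) : ‖(x : Ambient k) - y‖ ≤ 2 := by
  refine (norm_sub_le _ _).trans ?_
  rw [norm_sphere, norm_sphere]
  norm_num

theorem IsGradLipschitz.continuous {g : ℝ → ℝ} {L : ℝ} (hL : IsGradLipschitz k ε g L)
    (x : cap k ε) : Continuous fun y : cap k ε => interactionGrad g (x : Sphere k) y := by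
  refine (LipschitzWith.of_dist_le' (K := L) fun y y' => ?_).continuous
  rw [dist_eq_norm, Subtype.dist_eq, Subtype.dist_eq, dist_eq_norm]
  simpa using hL x y x y'

theorem IsGradLipschitz.integrable {g : ℝ → ℝ} {L : ℝ} (hL0 : 0 ≤ L)
    (hL : IsGradLipschitz k ε g L) (x : cap k ε) {α : Type*} [MeasurableSpace α] {π : Measure α}
    [IsFiniteMeasure π] {F : α → cap k ε} (hF : AEMeasurable F π) :
    Integrable (fun p => interactionGrad g (x : Sphere k) (F p)) π := by
  refine Integrable.of_bound
    ((hL.continuous x).measurable.comp_aemeasurable hF).aestronglyMeasurable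
    (‖interactionGrad g (x : Sphere k) x‖ + L * 2) (Eventually.of_forall fun p => ?_)
  have h := hL x (F p) x x
  rw [sub_self, norm_zero, zero_add] at h
  have h2 := norm_sub_norm_le (interactionGrad g (x : Sphere k) (F p))
    (interactionGrad g (x : Sphere k) x)
  have h3 : L * ‖((F p : Sphere k) : Ambient k) - (x : Sphere k)‖ ≤ L * 2 := by
    gcongr
    exact norm_sub_le_two _ _
  linarith

theorem integrable_norm_sub {α : Type*} [MeasurableSpace α] {π : Measure α} [IsFiniteMeasure π]
    {F F' : α → cap k ε} (hF : AEMeasurable F π) (hF' : AEMeasurable F' π) :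
    Integrable (fun p => ‖((F p : Sphere k) : Ambient k) - (F' p : Sphere k)‖) π := by
  have hc : Continuous fun x : cap k ε => ((x : Sphere k) : Ambient k) := by fun_prop
  refine Integrable.of_bound
    ((hc.measurable.comp_aemeasurable hF).sub
      (hc.measurable.comp_aemeasurable hF')).norm.aestronglyMeasurable
    2 (Eventually.of_forall fun p => ?_)
  rw [norm_norm]
  exact norm_sub_le_two _ _

theorem velocity_eq_integral {K : Sphere k → Sphere k → ℝ} {g : ℝ → ℝ}
    (hg : DifferentiableOn ℝ g (Set.Ici 0)) (hK : ∀ x y, K x y = g (geoDist x y ^ 2))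
    (hε : 0 < ε) {L : ℝ} (hL : IsGradLipschitz k ε g L) {ρ : ℝ → ProbabilityMeasure (cap k ε)}
    {α : Type*} [MeasurableSpace α] {π : Measure α} {F : α → cap k ε} (hF : AEMeasurable F π)
    {t : ℝ} (hmap : π.map F = ρ t) (x : cap k ε) :
    velocity K ρ x t = -∫ p, interactionGrad g (x : Sphere k) (F p) ∂π := by
  have h : ∀ y : cap k ε, sphereGrad (fun z => K z (y : Sphere k)) (x : Sphere k) =
      interactionGrad g (x : Sphere k) y := fun y =>
    sphereGrad_eq_interactionGrad hg hK
      ((geoDist_le_of_mem_cap x.2 y.2).trans_lt (by linarith))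
  simp only [velocity, h]
  rw [← hmap, integral_map hF (hL.continuous x).aestronglyMeasurable]

/-- Both velocities become integrals over the same space `π`, so the kernel bound applies under the
integral sign. -/
theorem norm_velocity_sub_le {K : Sphere k → Sphere k → ℝ} {g : ℝ → ℝ}
    (hg : DifferentiableOn ℝ g (Set.Ici 0)) (hK : ∀ x y, K x y = g (geoDist x y ^ 2))
    (hε : 0 < ε) {L : ℝ} (hL0 : 0 ≤ L) (hL : IsGradLipschitz k ε g L)
    {ρ ρ' : ℝ → ProbabilityMeasure (cap k ε)} {α : Type*} [MeasurableSpace α] {π : Measure α}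
    [IsProbabilityMeasure π] {F F' : α → cap k ε} (hF : AEMeasurable F π) (hF' : AEMeasurable F' π)
    {t : ℝ} (hmap : π.map F = ρ t) (hmap' : π.map F' = ρ' t) (x x' : cap k ε) :
    ‖velocity K ρ x t - velocity K ρ' x' t‖ ≤
      L * ‖((x : Sphere k) : Ambient k) - (x' : Sphere k)‖ +
        L * ∫ p, ‖((F p : Sphere k) : Ambient k) - (F' p : Sphere k)‖ ∂π := by
  rw [velocity_eq_integral hg hK hε hL hF hmap, velocity_eq_integral hg hK hε hL hF' hmap',
    neg_sub_neg, norm_sub_rev, ← integral_sub (hL.integrable hL0 x hF) (hL.integrable hL0 x' hF')]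
  have hi := integrable_norm_sub hF hF'
  calc _ ≤ ∫ p, L * (‖((x : Sphere k) : Ambient k) - (x' : Sphere k)‖ +
        ‖((F p : Sphere k) : Ambient k) - (F' p : Sphere k)‖) ∂π :=
        norm_integral_le_of_norm_le (((integrable_const _).add hi).const_mul L)
          (Eventually.of_forall fun p => hL _ _ _ _)
    _ = _ := by
        rw [integral_const_mul, integral_add (integrable_const _) hi]
        simp [mul_add]

/-- `Measure.map` is `0` on maps that are not a.e. measurable, so the push-forward identity of a
weak solution already contains measurability of the flow. -/
theorem aemeasurable_of_map_eq {μ ν : ProbabilityMeasure (cap k ε)} {F : cap k ε → cap k ε}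
    (h : (ν : Measure (cap k ε)) = (μ : Measure (cap k ε)).map F) :
    AEMeasurable F (μ : Measure (cap k ε)) := by
  by_contra hF
  rw [Measure.map_of_not_aemeasurable hF] at h
  exact IsProbabilityMeasure.ne_zero (ν : Measure (cap k ε)) h

/-! ### Stability of the flows and of the Wasserstein distance -/

/-- Gronwall gives `‖γ 0‖ e^{Lt} + B (e^{Lt} - 1)`. The threshold `3 / 2` keeps the coefficient of
`B` at `1 / 2`, so that `B` can later be absorbed. -/
theorem gronwall_three_halves {E : Type*} [NormedAddCommGroup E] [NormedSpace ℝ E]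
    {γ γ' : ℝ → E} {L τ B : ℝ} (hL : 0 < L) (hB : 0 ≤ B) (hτ : Real.exp (L * τ) ≤ 3 / 2)
    (hγ : ∀ t ∈ Set.Icc 0 τ, HasDerivWithinAt γ (γ' t) (Set.Icc 0 τ) t)
    (hγ' : ∀ t ∈ Set.Icc 0 τ, ‖γ' t‖ ≤ L * ‖γ t‖ + L * B) {t : ℝ} (ht : t ∈ Set.Icc 0 τ) :
    ‖γ t‖ ≤ 3 / 2 * ‖γ 0‖ + B / 2 := by
  have h := norm_le_gronwallBound_of_norm_deriv_right_le (f := γ) (f' := γ') (δ := ‖γ 0‖) (K := L)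
    (ε := L * B) (a := 0) (b := τ) (fun s hs => (hγ s hs).continuousWithinAt)
    (fun s hs => (hγ s ⟨hs.1, hs.2.le⟩).mono_of_mem_nhdsWithin
      (mem_of_superset (Icc_mem_nhdsGE hs.2) (Set.Icc_subset_Icc_left hs.1)))
    le_rfl (fun s hs => hγ' s ⟨hs.1, hs.2.le⟩) t ht
  rw [gronwallBound_of_K_ne_0 hL.ne', sub_zero, mul_div_cancel_left₀ _ hL.ne'] at h
  have he : Real.exp (L * t) ≤ 3 / 2 := by
    refine le_trans ?_ hτ
    gcongr
    exact ht.2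
  have h1 : ‖γ 0‖ * Real.exp (L * t) ≤ ‖γ 0‖ * (3 / 2) := by gcongr
  have h2 : B * (Real.exp (L * t) - 1) ≤ B * (3 / 2 - 1) := by gcongr
  linarith

theorem integral_norm_sub_flow_le {K : Sphere k → Sphere k → ℝ} {g : ℝ → ℝ}
    (hg : DifferentiableOn ℝ g (Set.Ici 0)) (hK : ∀ x y, K x y = g (geoDist x y ^ 2))
    (hε : 0 < ε) {L : ℝ} (hL0 : 0 < L) (hL : IsGradLipschitz k ε g L) {T : EReal} {τ : ℝ}
    (hτT : (τ : EReal) < T) (hτ : Real.exp (L * τ) ≤ 3 / 2)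
    {ρ ρ' : ℝ → ProbabilityMeasure (cap k ε)} {Ψ Ψ' : cap k ε → ℝ → cap k ε}
    (hΨ : IsFlowMap (velocity K ρ) (ρ 0 : Measure (cap k ε)).support T Ψ)
    (hΨ' : IsFlowMap (velocity K ρ') (ρ' 0 : Measure (cap k ε)).support T Ψ')
    {π : Measure (cap k ε × cap k ε)} [IsProbabilityMeasure π]
    (h1 : ∀ᵐ p ∂π, p.1 ∈ (ρ 0 : Measure (cap k ε)).support)
    (h2 : ∀ᵐ p ∂π, p.2 ∈ (ρ' 0 : Measure (cap k ε)).support)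
    (hm : ∀ t ∈ Set.Icc 0 τ, AEMeasurable (fun p => Ψ p.1 t) π)
    (hm' : ∀ t ∈ Set.Icc 0 τ, AEMeasurable (fun p => Ψ' p.2 t) π)
    (hmap : ∀ t ∈ Set.Icc 0 τ, π.map (fun p => Ψ p.1 t) = ρ t)
    (hmap' : ∀ t ∈ Set.Icc 0 τ, π.map (fun p => Ψ' p.2 t) = ρ' t)
    {t : ℝ} (ht : t ∈ Set.Icc 0 τ) :
    ∫ p, ‖((Ψ p.1 t : Sphere k) : Ambient k) - (Ψ' p.2 t : Sphere k)‖ ∂π ≤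
      3 * ∫ p, ‖((p.1 : Sphere k) : Ambient k) - (p.2 : Sphere k)‖ ∂π := by
  have hsub : Set.Icc 0 τ ⊆ timeInterval T := fun s hs =>
    ⟨hs.1, (EReal.coe_le_coe_iff.2 hs.2).trans_lt hτT⟩
  set f : ℝ → ℝ := fun t =>
    ∫ p, ‖((Ψ p.1 t : Sphere k) : Ambient k) - (Ψ' p.2 t : Sphere k)‖ ∂π with hf
  set f₀ : ℝ := ∫ p, ‖((p.1 : Sphere k) : Ambient k) - (p.2 : Sphere k)‖ ∂π with hf₀
  have hint : ∀ t ∈ Set.Icc 0 τ, Integrable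
      (fun p : cap k ε × cap k ε =>
        ‖((Ψ p.1 t : Sphere k) : Ambient k) - (Ψ' p.2 t : Sphere k)‖) π :=
    fun t ht => integrable_norm_sub (hm t ht) (hm' t ht)
  have hint₀ : Integrable (fun p : cap k ε × cap k ε =>
      ‖((p.1 : Sphere k) : Ambient k) - (p.2 : Sphere k)‖) π :=
    integrable_norm_sub measurable_fst.aemeasurable measurable_snd.aemeasurable
  have hf2 : ∀ t ∈ Set.Icc 0 τ, f t ≤ 2 := fun t ht => by
    calc f t ≤ ∫ _, (2 : ℝ) ∂π :=
          integral_mono (hint t ht) (integrable_const _) fun p => norm_sub_le_two _ _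
      _ = 2 := by simp
  have hbdd : BddAbove (f '' Set.Icc 0 τ) := ⟨2, by rintro _ ⟨t, ht, rfl⟩; exact hf2 t ht⟩
  -- Using the supremum of the mean distance as a constant forcing term avoids any regularity of `f`
  -- in time.
  set B := sSup (f '' Set.Icc 0 τ) with hB
  have hfB : ∀ t ∈ Set.Icc 0 τ, f t ≤ B := fun t ht => le_csSup hbdd ⟨t, ht, rfl⟩
  have hf_nonneg : ∀ t, 0 ≤ f t := fun t => integral_nonneg fun p => norm_nonneg _
  have hB0 : 0 ≤ B := (hf_nonneg t).trans (hfB t ht)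
  have hpt : ∀ t ∈ Set.Icc 0 τ, ∀ᵐ p ∂π,
      ‖((Ψ p.1 t : Sphere k) : Ambient k) - (Ψ' p.2 t : Sphere k)‖ ≤
        3 / 2 * ‖((p.1 : Sphere k) : Ambient k) - (p.2 : Sphere k)‖ + B / 2 := by
    intro t ht
    filter_upwards [h1, h2] with p hp1 hp2
    obtain ⟨hc0, hc⟩ := hΨ p.1 hp1
    obtain ⟨hc0', hc'⟩ := hΨ' p.2 hp2
    have h := gronwall_three_halves
      (γ := fun s => ((Ψ p.1 s : Sphere k) : Ambient k) - (Ψ' p.2 s : Sphere k))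
      (γ' := fun s => velocity K ρ (Ψ p.1 s) s - velocity K ρ' (Ψ' p.2 s) s) hL0 hB0 hτ
      (fun s hs => ((hc s (hsub hs)).mono hsub).sub ((hc' s (hsub hs)).mono hsub))
      (fun s hs => (norm_velocity_sub_le hg hK hε hL0.le hL (hm s hs) (hm' s hs) (hmap s hs)
        (hmap' s hs) _ _).trans (by gcongr; exact hfB s hs)) ht
    simpa only [hc0, hc0'] using h
  have hhalf : ∀ t ∈ Set.Icc 0 τ, f t ≤ 3 / 2 * f₀ + B / 2 := by
    intro t ht
    calc f t ≤ ∫ p, (3 / 2 * ‖((p.1 : Sphere k) : Ambient k) - (p.2 : Sphere k)‖ + B / 2) ∂π :=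
          integral_mono_ae (hint t ht) ((hint₀.const_mul _).add (integrable_const _)) (hpt t ht)
      _ = _ := by
          rw [integral_add (hint₀.const_mul _) (integrable_const _), integral_const_mul]
          simp [hf₀]
  -- Absorbing `B / 2`, which is legitimate as `B` is a real number, gives `B ≤ 3 * f₀`.
  have hBle : B ≤ 3 / 2 * f₀ + B / 2 :=
    csSup_le ⟨_, t, ht, rfl⟩ (by rintro _ ⟨s, hs, rfl⟩; exact hhalf s hs)
  linarith [hfB t ht]

theorem isProbabilityMeasure_of_mem_transportPlans {μ ν : ProbabilityMeasure (cap k ε)}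
    {π : Measure (cap k ε × cap k ε)} (hπ : π ∈ transportPlans μ ν) : IsProbabilityMeasure π := by
  have : IsProbabilityMeasure (π.map Prod.fst) := by rw [hπ.1]; infer_instance
  exact Measure.isProbabilityMeasure_of_map Prod.fst

theorem W1_le_of_transportPlan {K : Sphere k → Sphere k → ℝ} {g : ℝ → ℝ}
    (hg : DifferentiableOn ℝ g (Set.Ici 0)) (hK : ∀ x y, K x y = g (geoDist x y ^ 2))
    (hε : 0 < ε) {L : ℝ} (hL0 : 0 < L) (hL : IsGradLipschitz k ε g L) {T : EReal} {τ : ℝ}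
    (hτT : (τ : EReal) < T) (hτ : Real.exp (L * τ) ≤ 3 / 2)
    {ρ ρ' : ℝ → ProbabilityMeasure (cap k ε)} (hρ : IsWeakSolution K T ρ)
    (hρ' : IsWeakSolution K T ρ') {π : Measure (cap k ε × cap k ε)}
    (hπ : π ∈ transportPlans (ρ 0) (ρ' 0)) {t : ℝ} (ht : t ∈ Set.Icc 0 τ) :
    W1 (ρ t) (ρ' t) ≤ ENNReal.ofReal (Real.pi / 2 * 3) *
      ∫⁻ p : cap k ε × cap k ε, ENNReal.ofReal (geoDist (p.1 : Sphere k) (p.2 : Sphere k)) ∂π := by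
  have hsub : Set.Icc 0 τ ⊆ timeInterval T := fun s hs =>
    ⟨hs.1, (EReal.coe_le_coe_iff.2 hs.2).trans_lt hτT⟩
  have := isProbabilityMeasure_of_mem_transportPlans hπ
  obtain ⟨Ψ, hΨ, -, hpush⟩ := hρ
  obtain ⟨Ψ', hΨ', -, hpush'⟩ := hρ'
  obtain ⟨hfst, hsnd⟩ := hπ
  have hA : ∀ s ∈ Set.Icc 0 τ, AEMeasurable (fun x => Ψ x s) (π.map Prod.fst) := fun s hs => by
    rw [hfst]; exact aemeasurable_of_map_eq (hpush s (hsub hs))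
  have hA' : ∀ s ∈ Set.Icc 0 τ, AEMeasurable (fun x => Ψ' x s) (π.map Prod.snd) := fun s hs => by
    rw [hsnd]; exact aemeasurable_of_map_eq (hpush' s (hsub hs))
  have hm : ∀ s ∈ Set.Icc 0 τ, AEMeasurable (fun p : cap k ε × cap k ε => Ψ p.1 s) π :=
    fun s hs => (hA s hs).comp_measurable measurable_fst
  have hm' : ∀ s ∈ Set.Icc 0 τ, AEMeasurable (fun p : cap k ε × cap k ε => Ψ' p.2 s) π :=
    fun s hs => (hA' s hs).comp_measurable measurable_snd
  have hmap : ∀ s ∈ Set.Icc 0 τ, π.map (fun p => Ψ p.1 s) = ρ s := fun s hs => by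
    rw [hpush s (hsub hs), ← hfst,
      AEMeasurable.map_map_of_aemeasurable (hA s hs) measurable_fst.aemeasurable]
    rfl
  have hmap' : ∀ s ∈ Set.Icc 0 τ, π.map (fun p => Ψ' p.2 s) = ρ' s := fun s hs => by
    rw [hpush' s (hsub hs), ← hsnd,
      AEMeasurable.map_map_of_aemeasurable (hA' s hs) measurable_snd.aemeasurable]
    rfl
  -- The flows are controlled only on the supports, which carry full measure.
  have h1 : ∀ᵐ p ∂π, p.1 ∈ (ρ 0 : Measure (cap k ε)).support :=
    ae_of_ae_map measurable_fst.aemeasurable (by rw [hfst]; exact Measure.support_mem_ae)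
  have h2 : ∀ᵐ p ∂π, p.2 ∈ (ρ' 0 : Measure (cap k ε)).support :=
    ae_of_ae_map measurable_snd.aemeasurable (by rw [hsnd]; exact Measure.support_mem_ae)
  have key := integral_norm_sub_flow_le hg hK hε hL0 hL hτT hτ hΨ hΨ' h1 h2 hm hm' hmap hmap' ht
  have hpair : AEMeasurable (fun p : cap k ε × cap k ε => (Ψ p.1 t, Ψ' p.2 t)) π :=
    (hm t ht).prodMk (hm' t ht)
  have hplan : π.map (fun p => (Ψ p.1 t, Ψ' p.2 t)) ∈ transportPlans (ρ t) (ρ' t) := by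
    constructor
    · rw [AEMeasurable.map_map_of_aemeasurable measurable_fst.aemeasurable hpair, ← hmap t ht]
      rfl
    · rw [AEMeasurable.map_map_of_aemeasurable measurable_snd.aemeasurable hpair, ← hmap' t ht]
      rfl
  have hpi := Real.pi_pos
  calc W1 (ρ t) (ρ' t)
      ≤ ∫⁻ p : cap k ε × cap k ε, ENNReal.ofReal (geoDist (p.1 : Sphere k) (p.2 : Sphere k))
          ∂π.map (fun p => (Ψ p.1 t, Ψ' p.2 t)) := iInf₂_le _ hplan
    _ = ∫⁻ p, ENNReal.ofReal (geoDist (Ψ p.1 t : Sphere k) (Ψ' p.2 t : Sphere k)) ∂π :=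
        lintegral_map' continuous_geoDist.measurable.ennreal_ofReal.aemeasurable hpair
    _ ≤ ∫⁻ p, ENNReal.ofReal
          (Real.pi / 2 * ‖((Ψ p.1 t : Sphere k) : Ambient k) - (Ψ' p.2 t : Sphere k)‖) ∂π :=
        lintegral_mono fun p => ENNReal.ofReal_le_ofReal (geoDist_le_norm_sub _ _)
    _ = ENNReal.ofReal (Real.pi / 2 *
          ∫ p, ‖((Ψ p.1 t : Sphere k) : Ambient k) - (Ψ' p.2 t : Sphere k)‖ ∂π) := by
        rw [← integral_const_mul, ofReal_integral_eq_lintegral_ofReal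
          ((integrable_norm_sub (hm t ht) (hm' t ht)).const_mul _)
          (Eventually.of_forall fun p => by positivity)]
    _ ≤ ENNReal.ofReal (Real.pi / 2 * 3 *
          ∫ p, ‖((p.1 : Sphere k) : Ambient k) - (p.2 : Sphere k)‖ ∂π) := by
        rw [mul_assoc]
        gcongr
    _ = ENNReal.ofReal (Real.pi / 2 * 3) *
          ∫⁻ p, ENNReal.ofReal ‖((p.1 : Sphere k) : Ambient k) - (p.2 : Sphere k)‖ ∂π := by
        rw [ENNReal.ofReal_mul (by positivity), ofReal_integral_eq_lintegral_ofReal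
          (integrable_norm_sub measurable_fst.aemeasurable measurable_snd.aemeasurable)
          (Eventually.of_forall fun p => norm_nonneg _)]
    _ ≤ _ := by
        gcongr with p
        exact norm_sub_le_geoDist _ _

/-! ### Atomic measures -/

theorem mem_support_atomicMeasure {N : ℕ} {m : Fin N → ℝ} (hm : IsMassVector m)
    (x : Fin N → cap k ε) (i : Fin N) : x i ∈ (atomicMeasure m x).support := by
  rw [Measure.mem_support_iff_forall]
  intro U hU
  simp only [atomicMeasure, Measure.coe_finsetSum, Finset.sum_apply, Measure.smul_apply,
    smul_eq_mul]
  refine lt_of_lt_of_le ?_ (Finset.single_le_sum (fun _ _ => zero_le) (Finset.mem_univ i))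
  simp [Measure.dirac_apply_of_mem (mem_of_mem_nhds hU), hm.1 i]

theorem map_atomicMeasure {N : ℕ} (m : Fin N → ℝ) (x : Fin N → cap k ε) {F : cap k ε → cap k ε}
    (hF : AEMeasurable F (atomicMeasure m x)) :
    (atomicMeasure m x).map F = atomicMeasure m (fun i => F (x i)) := by
  ext s hs
  rw [Measure.map_apply_of_aemeasurable hF hs]
  simp only [atomicMeasure, Measure.coe_finsetSum, Finset.sum_apply, Measure.smul_apply,
    Measure.dirac_apply]
  rfl

end SphereAggregation

/-! ### The mean-field limit -/

open SphereAggregation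
theorem mainTheorem5 (k : ℕ) (ε : ℝ) (hε : ε ∈ Set.Ioo 0 (Real.pi / 2))
    (K : Sphere k → Sphere k → ℝ) (hK : IsAdmissiblePotential K)
    -- the initial measure and the empirical initial measures
    (ρ₀ : ProbabilityMeasure (cap k ε))
    (N : ℕ → ℕ) (m : (n : ℕ) → Fin (N n) → ℝ) (x₀ : (n : ℕ) → Fin (N n) → cap k ε)
    (hm : ∀ n, IsMassVector (m n))
    (ρ₀n : ℕ → ProbabilityMeasure (cap k ε))
    (hρ₀n : ∀ n, (ρ₀n n : Measure (cap k ε)) = atomicMeasure (m n) (x₀ n))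
    (hconv : Tendsto (fun n => W1 (ρ₀n n) ρ₀) atTop (𝓝 0))
    -- the weak solutions on `[0, T)`
    (T : EReal) (hT : 0 < T)
    (ρ : ℝ → ProbabilityMeasure (cap k ε)) (hρ : IsWeakSolution K T ρ) (hρ0 : ρ 0 = ρ₀)
    (ρn : ℕ → ℝ → ProbabilityMeasure (cap k ε))
    (hρn : ∀ n, IsWeakSolution K T (ρn n)) (hρn0 : ∀ n, ρn n 0 = ρ₀n n) :
    -- each `ρn n` is a particle solution
    (∀ n, ∃ x : Fin (N n) → ℝ → cap k ε,
      (∀ i, IsIntegralCurveFrom (velocity K (ρn n)) T (x₀ n i) (x i)) ∧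
      ∀ t ∈ timeInterval T,
        (ρn n t : Measure (cap k ε)) = atomicMeasure (m n) (fun i => x i t)) ∧
    -- mean-field limit
    ∃ Tstar : ℝ, 0 < Tstar ∧ (Tstar : EReal) < T ∧
      Tendsto (fun n => ⨆ t ∈ Set.Ico 0 Tstar, W1 (ρn n t) (ρ t)) atTop (𝓝 0) := by
  constructor
  · intro n
    obtain ⟨Ψ, hΨ, -, hpush⟩ := hρn n
    have h0 : (ρn n 0 : Measure (cap k ε)) = atomicMeasure (m n) (x₀ n) := by
      rw [hρn0, hρ₀n]
    refine ⟨fun i => Ψ (x₀ n i), fun i => hΨ _ ?_, fun t ht => ?_⟩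
    · rw [h0]
      exact mem_support_atomicMeasure (hm n) (x₀ n) i
    · have hF := aemeasurable_of_map_eq (hpush t ht)
      rw [h0] at hF
      rw [hpush t ht, h0, map_atomicMeasure _ _ hF]
  · obtain ⟨g, hg, hg', hKg⟩ := hK
    obtain ⟨L, hL0, hL⟩ := exists_interactionGrad_bound (k := k) hg' hε
    have hGL : IsGradLipschitz k ε g L := fun x y x' y' => hL _ x.2 _ y.2 _ x'.2 _ y'.2
    -- A real time below `T`, which may be infinite; `τ` is then shortened so that `exp (L * τ) ≤ 3
    -- / 2`.
    obtain ⟨r, hr0, hrT⟩ := EReal.lt_iff_exists_real_btwn.1 hT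
    have hr : 0 < r := by exact_mod_cast hr0
    have hlog : 0 < Real.log (3 / 2) := Real.log_pos (by norm_num)
    set τ := min r (Real.log (3 / 2) / L) with hτdef
    have hτ0 : 0 < τ := lt_min hr (div_pos hlog hL0)
    have hτT : (τ : EReal) < T := (EReal.coe_le_coe_iff.2 (min_le_left _ _)).trans_lt hrT
    have hτ : Real.exp (L * τ) ≤ 3 / 2 := by
      rw [← Real.le_log_iff_exp_le (by norm_num), mul_comm, ← le_div_iff₀ hL0]
      exact min_le_right _ _
    refine ⟨τ, hτ0, hτT, ?_⟩
    set C := ENNReal.ofReal (Real.pi / 2 * 3) with hC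
    have hC0 : C ≠ 0 := by
      have := Real.pi_pos
      rw [hC, Ne, ENNReal.ofReal_eq_zero]
      linarith
    have hbound : ∀ n, ⨆ t ∈ Set.Ico 0 τ, W1 (ρn n t) (ρ t) ≤ C * W1 (ρ₀n n) ρ₀ := by
      intro n
      refine iSup₂_le fun t ht => ?_
      -- Dividing by `C` isolates the infimum over plans, so the bound is needed plan by plan and no
      -- optimal plan is required.
      rw [mul_comm, ← ENNReal.div_le_iff hC0 ENNReal.ofReal_ne_top]
      refine le_iInf₂ fun π hπ => ?_
      rw [ENNReal.div_le_iff hC0 ENNReal.ofReal_ne_top, mul_comm]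
      exact W1_le_of_transportPlan hg hKg hε.1 hL0 hGL hτT hτ (hρn n) hρ
        (by rwa [hρn0, hρ0]) ⟨ht.1, ht.2.le⟩
    have hlim : Tendsto (fun n => C * W1 (ρ₀n n) ρ₀) atTop (𝓝 0) := by
      simpa using ENNReal.Tendsto.const_mul hconv (Or.inr (ENNReal.ofReal_ne_top (r := _)))
    exact tendsto_of_tendsto_of_tendsto_of_le_of_le tendsto_const_nhds hlim
      (fun n => zero_le) hbound
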